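/- A FIDL-module is a structure $\mathcal M=\langle \mathbf A,\mathbf B,f,i\rangle$ in which $\mathbf A$ and $\mathbf B$ are bounded distributive lattices and $f\colon A\times B\to A$, $i\colon B\times A\to A$ are functions such that, for all $x,y\in A$ and $b,c\in B$, (F1) $f(x\vee y,b)=f(x,b)\vee f(y,b)$; (F2) $f(x,b\vee c)=f(x,b)\vee f(x,c)$; (F3) $f(0,b)=0$; (F4) $f(x,0)=0$; (I1) $i(b,x\wedge y)=i(b,x)\wedge i(b,y)$; (I2) $i(b\vee c,x)=i(b,x)\wedge i(c,x)$; (I3) $i(b,1)=1$; (I4) $i(0,x)=1$. A FIDL-homomorphism $\langle \mathbf A,\mathbf B,f,i\rangle\to\langle \hat{\mathbf A},\hat{\mathbf B},\hat f,\hat i\rangle$ is a pair $(\alpha,\gamma)$ of homomorphisms of bounded lattices $\alpha\colon A\to\hat A$, $\gamma\colon B\to\hat B$ with $\alpha(f(x,b))=\hat f(\alpha(x),\gamma(b))$ and $\alpha(i(b,x))=\hat i(\gamma(b),\alpha(x))$ for all $x\in A$, $b\in B$. Let $\mathsf{FIMod}$ be the category of FIDL-modules and FIDL-homomorphisms, with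 componentwise composition. A Priestley space is a compact topological space with a partial order such that whenever $x\not\le y$ there is a clopen increasing set containing $x$ but not $y$. For a Priestley space $X$ let $\mathcal C(X)$ be the set of its clopen increasing subsets, and for $x\in X$ let $\epsilon_X(x)=\{U\in\mathcal C(X): x\in U\}$. Let $X$, $Y$ be Priestley spaces, $R\subseteq X\times Y\times X$ and $T\subseteq Y\times X\times X$. For $V\subseteq X$ and $U\subseteq Y$ put $$f(V,U)=\{z\in X:\ \exists\, x\in V,\ y\in U \text{ with } (x,y,z)\in R\},$$ $$i(U,V)=\{y\in X:\ \forall x\in Y\ \forall z\in X,\ \text{if } (x,y,z)\in T \text{ and } x\in U, \text{ then } z\in V\},$$ and for $G\subseteq\mathcal C(X)$ and $H\subseteq\mathcal C(Y)$ put $$f(G,H)=\{W\in\mathcal C(X):\ f(V,U)\subseteq W\text{ for some }V\in G,\ U\in H\},$$ $$i(H,G)=\{W\in\mathcal C(X):\ V\subseteq i(U,W)\text{ for some }U\in H,\ V\in G\}.$$ The structure $\mathcal U=\langle X,Y,R,T\rangle$ is an Urquhart space if $f(V,U)\in\mathcal C(X)$ and $i(U,V)\in\mathcal C(X)$ for all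 $V\in\mathcal C(X)$ and $U\in\mathcal C(Y)$, and if for all $x\in Y$ and $y,z\in X$: $f(\epsilon_X(y),\epsilon_Y(x))\subseteq\epsilon_X(z)$ implies $(y,x,z)\in R$, and $i(\epsilon_Y(x),\epsilon_X(y))\subseteq\epsilon_X(z)$ implies $(x,y,z)\in T$. A U-map $\langle X,Y,R,T\rangle\to\langle\hat X,\hat Y,\hat R,\hat T\rangle$ is a pair $(g,h)$ of continuous monotone maps $g\colon X\to\hat X$, $h\colon Y\to\hat Y$ such that (M1) if $(x,y,z)\in R$, then $(g(x),h(y),g(z))\in\hat R$; (M2) if $(\bar x,\bar y,g(z))\in\hat R$, then there are $x\in X$, $y\in Y$ with $(x,y,z)\in R$, $\bar x\le g(x)$ and $\bar y\le h(y)$; (N1) if $(x,y,z)\in T$, then $(h(x),g(y),g(z))\in\hat T$; (N2) if $(\bar x,g(y),\bar z)\in\hat T$, then there are $x\in Y$, $z\in X$ with $(x,y,z)\in T$, $\bar x\le h(x)$ and $g(z)\le\bar z$. Let $\mathsf{USp}$ be the category of Urquhart spaces and U-maps, with componentwise composition. **Theorem.** The categories $\mathsf{FIMod}$ and $\mathsf{USp}$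 are dually equivalent, i.e. $\mathsf{FIMod}^{\mathrm{op}}$ and $\mathsf{USp}$ are equivalent categories. -/

import Mathlib

open CategoryTheory Opposite

universe u v

/-- A FIDL-module `⟨A, B, f, i⟩`: two bounded distributive lattices (possibly trivial) with
`f : A × B → A` and `i : B × A → A`. -/
structure FIMod where
  A : Type u
  B : Type v
  [latA : DistribLattice A]
  [bddA : BoundedOrder A]
  [latB : DistribLattice B]
  [bddB : BoundedOrder B]
  f : A → B → A
  i : B → A → A
  /-- (F1) -/
  f_sup_left : ∀ x y b, f (x ⊔ y) b = f x b ⊔ f y b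
  /-- (F2) -/
  f_sup_right : ∀ x b c, f x (b ⊔ c) = f x b ⊔ f x c
  /-- (F3) -/
  f_bot_left : ∀ b, f ⊥ b = ⊥
  /-- (F4) -/
  f_bot_right : ∀ x, f x ⊥ = ⊥
  /-- (I1) -/
  i_inf : ∀ b x y, i b (x ⊓ y) = i b x ⊓ i b y
  /-- (I2) -/
  i_sup : ∀ b c x, i (b ⊔ c) x = i b x ⊓ i c x
  /-- (I3) -/
  i_top : ∀ b, i b ⊤ = ⊤
  /-- (I4), the counterpart of (F4) -/
  i_bot : ∀ x, i ⊥ x = ⊤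

namespace FIMod

attribute [instance] latA bddA latB bddB

/-- A FIDL-homomorphism: a pair of bounded lattice homomorphisms commuting with `f` and `i`. -/
@[ext]
structure Hom (M N : FIMod.{u, v}) where
  α : BoundedLatticeHom M.A N.A
  γ : BoundedLatticeHom M.B N.B
  map_f : ∀ x b, α (M.f x b) = N.f (α x) (γ b)
  map_i : ∀ b x, α (M.i b x) = N.i (γ b) (α x)

/-- The category of FIDL-modules and FIDL-homomorphisms, with componentwise composition. -/
instance : Category FIMod.{u, v} where
  Hom := Hom
  id M :=
    { α := BoundedLatticeHom.id M.A
      γ := BoundedLatticeHom.id M.B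
      map_f := fun _ _ => rfl
      map_i := fun _ _ => rfl }
  comp φ ψ :=
    { α := ψ.α.comp φ.α
      γ := ψ.γ.comp φ.γ
      map_f := fun x b => by simp [φ.map_f, ψ.map_f]
      map_i := fun b x => by simp [φ.map_i, ψ.map_i] }

end FIMod

namespace Urquhart

section Operations

variable {X : Type u} {Y : Type v}

/-- `f(V, U) = {z | ∃ (x, y) ∈ V × U, (x, y, z) ∈ R}`. -/
def fusion (R : X → Y → X → Prop) (V : Set X) (U : Set Y) : Set X :=
  {z | ∃ x ∈ V, ∃ y ∈ U, R x y z}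

/-- `i(U, V) = {y | ∀ x z, (x, y, z) ∈ T and x ∈ U imply z ∈ V}`. -/
def implication (T : Y → X → X → Prop) (U : Set Y) (V : Set X) : Set X :=
  {y | ∀ x z, T x y z → x ∈ U → z ∈ V}

variable [TopologicalSpace X] [PartialOrder X] [TopologicalSpace Y] [PartialOrder Y]

/-- `ε(x)`, the set of clopen upper sets containing `x`. -/
def epsilon (x : X) : Set (ClopenUpperSet X) :=
  {U | x ∈ U}

/-- `f(G, H) = {W | ∃ (V, U) ∈ G × H, f(V, U) ⊆ W}` for sets `G`, `H` of clopen upper sets. -/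
def fusionFilter (R : X → Y → X → Prop) (G : Set (ClopenUpperSet X))
    (H : Set (ClopenUpperSet Y)) : Set (ClopenUpperSet X) :=
  {W | ∃ V ∈ G, ∃ U ∈ H, fusion R (V : Set X) (U : Set Y) ⊆ (W : Set X)}

/-- `i(H, G) = {W | ∃ (U, V) ∈ H × G, V ⊆ i(U, W)}` for sets `G`, `H` of clopen upper sets. -/
def implicationFilter (T : Y → X → X → Prop) (H : Set (ClopenUpperSet Y))
    (G : Set (ClopenUpperSet X)) : Set (ClopenUpperSet X) :=
  {W | ∃ U ∈ H, ∃ V ∈ G, (V : Set X) ⊆ implication T (U : Set Y) (W : Set X)}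

end Operations

end Urquhart

open Urquhart in
/-- An Urquhart space: Priestley spaces `X`, `Y` (possibly empty) with relations
`R ⊆ X × Y × X` and `T ⊆ Y × X × X`. -/
structure USp where
  X : Type u
  Y : Type v
  [topX : TopologicalSpace X]
  [ordX : PartialOrder X]
  [compactX : CompactSpace X]
  [priestleyX : PriestleySpace X]
  [topY : TopologicalSpace Y]
  [ordY : PartialOrder Y]
  [compactY : CompactSpace Y]
  [priestleyY : PriestleySpace Y]
  R : X → Y → X → Prop
  T : Y → X → X → Prop
  fusion_isClopen : ∀ (V : ClopenUpperSet X) (U : ClopenUpperSet Y),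
    IsClopen (fusion R (V : Set X) (U : Set Y))
  fusion_isUpperSet : ∀ (V : ClopenUpperSet X) (U : ClopenUpperSet Y),
    IsUpperSet (fusion R (V : Set X) (U : Set Y))
  implication_isClopen : ∀ (U : ClopenUpperSet Y) (V : ClopenUpperSet X),
    IsClopen (implication T (U : Set Y) (V : Set X))
  implication_isUpperSet : ∀ (U : ClopenUpperSet Y) (V : ClopenUpperSet X),
    IsUpperSet (implication T (U : Set Y) (V : Set X))
  R_of_subset : ∀ (y : X) (x : Y) (z : X),
    fusionFilter R (epsilon y) (epsilon x) ⊆ epsilon z → R y x z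
  T_of_subset : ∀ (x : Y) (y z : X),
    implicationFilter T (epsilon x) (epsilon y) ⊆ epsilon z → T x y z

namespace USp

attribute [instance] topX ordX compactX priestleyX topY ordY compactY priestleyY

/-- A U-map: a pair of continuous monotone maps satisfying (M1), (M2), (N1), (N2). -/
@[ext]
structure Hom (S S' : USp.{u, v}) where
  g : S.X →Co S'.X
  h : S.Y →Co S'.Y
  /-- (M1) -/
  map_R : ∀ x y z, S.R x y z → S'.R (g x) (h y) (g z)
  /-- (M2) -/
  lift_R : ∀ x' y' z, S'.R x' y' (g z) → ∃ x y, S.R x y z ∧ x' ≤ g x ∧ y' ≤ h y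
  /-- (N1) -/
  map_T : ∀ x y z, S.T x y z → S'.T (h x) (g y) (g z)
  /-- (N2) -/
  lift_T : ∀ x' y z', S'.T x' (g y) z' → ∃ x z, S.T x y z ∧ x' ≤ h x ∧ g z ≤ z'

/-- The category of Urquhart spaces and U-maps, with componentwise composition. -/
instance : Category USp.{u, v} where
  Hom := Hom
  id S :=
    { g := ContinuousOrderHom.id S.X
      h := ContinuousOrderHom.id S.Y
      map_R := fun _ _ _ hR => hR
      lift_R := fun x' y' _ hR => ⟨x', y', hR, le_rfl, le_rfl⟩
      map_T := fun _ _ _ hT => hT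
      lift_T := fun x' _ z' hT => ⟨x', z', hT, le_rfl, le_rfl⟩ }
  comp φ ψ :=
    { g := ψ.g.comp φ.g
      h := ψ.h.comp φ.h
      map_R := fun _ _ _ hR => ψ.map_R _ _ _ (φ.map_R _ _ _ hR)
      lift_R := fun x'' y'' z hR => by
        obtain ⟨x', y', h1, h2, h3⟩ := ψ.lift_R x'' y'' (φ.g z) hR
        obtain ⟨x, y, h4, h5, h6⟩ := φ.lift_R x' y' z h1
        exact ⟨x, y, h4, h2.trans (ψ.g.monotone' h5), h3.trans (ψ.h.monotone' h6)⟩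
      map_T := fun _ _ _ hT => ψ.map_T _ _ _ (φ.map_T _ _ _ hT)
      lift_T := fun x'' y z'' hT => by
        obtain ⟨x', z', h1, h2, h3⟩ := ψ.lift_T x'' (φ.g y) z'' hT
        obtain ⟨x, z, h4, h5, h6⟩ := φ.lift_T x' y z' h1
        exact ⟨x, z, h4, h2.trans (ψ.h.monotone' h5), (ψ.g.monotone' h6).trans h3⟩ }

end USp

/-! Priestley duality is applied to both lattices and extended to the operations. Taking clopen
upper sets, with `fusion` and `implication` as operations and preimages as morphisms, is a
contravariant functor; it is shown to be faithful, full and essentially surjective, so no unit on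
the space side is needed.

The engine is a pair of extension lemmas, `exists_primePoint_f` and `exists_primePoint_i`: data
related to a prime filter through `f` or `i` enlarge to prime filters still so related. For a
FIDL-module they supply the witnesses showing that the relations on prime filters reproduce `f` and
`i` (`fusion_basic`, `implication_basic`), hence essential surjectivity. For a map of spaces they
produce the points demanded by (M2) and (N2), because every prime filter of clopen upper sets comes
from a point (`exists_forall_mem_iff`). The closure axioms on `R` and `T` turn inclusions of filters
back into related points. -/

open Urquhart

/-! ### Prime filters and the Priestley dual of a lattice. -/

/-- The characteristic functions of the prime filters of a bounded lattice. -/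
def primeFilterSet (L : Type*) [Lattice L] [BoundedOrder L] : Set (L → Bool) :=
  {p | p ⊤ = true ∧ p ⊥ = false ∧ (∀ a b, p (a ⊔ b) = (p a || p b)) ∧
    ∀ a b, p (a ⊓ b) = (p a && p b)}

/-- The Priestley dual of a bounded lattice: its prime filters, ordered by inclusion, with the
topology of pointwise convergence of characteristic functions. -/
abbrev PrimePoint (L : Type*) [Lattice L] [BoundedOrder L] : Type _ :=
  primeFilterSet L

namespace PrimePoint

section Lattice

variable {L : Type*} [Lattice L] [BoundedOrder L]

theorem top (p : PrimePoint L) : p.1 ⊤ = true := p.2.1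

theorem bot (p : PrimePoint L) : ¬p.1 ⊥ = true := by simp [p.2.2.1]

theorem sup_iff (p : PrimePoint L) (a b : L) :
    p.1 (a ⊔ b) = true ↔ p.1 a = true ∨ p.1 b = true := by
  simp [p.2.2.2.1 a b]

theorem inf_iff (p : PrimePoint L) (a b : L) :
    p.1 (a ⊓ b) = true ↔ p.1 a = true ∧ p.1 b = true := by
  simp [p.2.2.2.2 a b]

theorem mono (p : PrimePoint L) {a b : L} (h : a ≤ b) (ha : p.1 a = true) : p.1 b = true := by
  rw [← sup_eq_right.2 h, sup_iff]
  exact Or.inl ha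

open Classical in
/-- The prime point attached to a predicate with the properties of a prime filter. -/
noncomputable def ofPred (P : L → Prop) (top : P ⊤) (bot : ¬P ⊥)
    (sup : ∀ a b, P (a ⊔ b) ↔ P a ∨ P b) (inf : ∀ a b, P (a ⊓ b) ↔ P a ∧ P b) : PrimePoint L :=
  ⟨fun a => decide (P a), by simpa using top, by simpa using bot,
    fun a b => by simp [sup], fun a b => by simp [inf]⟩

theorem le_iff {p q : PrimePoint L} : p ≤ q ↔ ∀ a, p.1 a = true → q.1 a = true :=
  Iff.rfl

theorem isClosed_primeFilterSet : IsClosed (primeFilterSet L) := by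
  have ev (a : L) : Continuous fun p : L → Bool => p a := continuous_apply a
  refine (isClosed_eq (ev _) continuous_const).inter
    ((isClosed_eq (ev _) continuous_const).inter (IsClosed.inter ?_ ?_))
  · have (a b : L) : IsClosed {p : L → Bool | p (a ⊔ b) = (p a || p b)} :=
      isClosed_eq (ev _) ((continuous_of_discreteTopology
        (f := fun t : Bool × Bool => t.1 || t.2)).comp ((ev a).prodMk (ev b)))
    change IsClosed {p : L → Bool | ∀ a b, p (a ⊔ b) = (p a || p b)}
    simp only [Set.ofPred_forall]
    exact isClosed_iInter fun a => isClosed_iInter (this a)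
  · have (a b : L) : IsClosed {p : L → Bool | p (a ⊓ b) = (p a && p b)} :=
      isClosed_eq (ev _) ((continuous_of_discreteTopology
        (f := fun t : Bool × Bool => t.1 && t.2)).comp ((ev a).prodMk (ev b)))
    change IsClosed {p : L → Bool | ∀ a b, p (a ⊓ b) = (p a && p b)}
    simp only [Set.ofPred_forall]
    exact isClosed_iInter fun a => isClosed_iInter (this a)

instance : CompactSpace (PrimePoint L) :=
  isCompact_iff_compactSpace.1 isClosed_primeFilterSet.isCompact

/-- The clopen upper set of prime points containing `a`. -/
def basic (a : L) : ClopenUpperSet (PrimePoint L) where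
  carrier := {p | p.1 a = true}
  isClopen' := (isClopen_discrete {true}).preimage
    ((continuous_apply a).comp continuous_subtype_val)
  upper' := fun _ _ h hp => h a hp

instance : PriestleySpace (PrimePoint L) where
  priestley {p q} h := by
    simp only [le_iff, not_forall] at h
    obtain ⟨a, hp, hq⟩ := h
    exact ⟨basic a, (basic a).isClopen, (basic a).upper, hp, hq⟩

/-- Every clopen upper set of the Priestley dual is given by an element of the lattice. -/
theorem basic_surjective : Function.Surjective (basic (L := L)) := by
  intro U
  have below (p : PrimePoint L) (hp : p ∈ U) :
      ∃ a, p.1 a = true ∧ (basic a : Set (PrimePoint L)) ⊆ U := by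
    have : Nonempty {a : L // p.1 a = true} := ⟨⟨⊤, p.top⟩⟩
    -- The sets `basic a` with `a` in `p` intersect in the points above `p`, all of which lie in
    -- `U`. By compactness one of them already misses the complement of `U`.
    obtain ⟨a, ha⟩ := (U.isClopen.compl.isClosed.isCompact).elim_directed_family_closed
      (fun a : {a : L // p.1 a = true} => (basic a.1 : Set (PrimePoint L)))
      (fun a => (basic a.1).isClopen.isClosed)
      (by
        ext q
        simp only [Set.mem_inter_iff, Set.mem_iInter, Set.mem_empty_iff_false, iff_false]
        exact fun hq => hq.1 (U.upper (fun a ha => hq.2 ⟨a, ha⟩) hp))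
      (fun a b => ⟨⟨a.1 ⊓ b.1, (p.inf_iff _ _).2 ⟨a.2, b.2⟩⟩,
        fun q hq => q.mono inf_le_left hq, fun q hq => q.mono inf_le_right hq⟩)
    refine ⟨a.1, a.2, fun q hq => by_contra fun hqU => ?_⟩
    exact (Set.eq_empty_iff_forall_notMem.1 ha q) ⟨hqU, hq⟩
  have : Nonempty {a : L // (basic a : Set (PrimePoint L)) ⊆ U} :=
    ⟨⟨⊥, fun q hq => (q.bot hq).elim⟩⟩
  obtain ⟨a, ha⟩ := (U.isClopen.isClosed.isCompact).elim_directed_cover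
    (fun a : {a : L // (basic a : Set (PrimePoint L)) ⊆ U} => (basic a.1 : Set (PrimePoint L)))
    (fun a => (basic a.1).isClopen.isOpen)
    (fun p hp => by
      obtain ⟨a, hpa, ha⟩ := below p hp
      exact Set.mem_iUnion.2 ⟨⟨a, ha⟩, hpa⟩)
    (fun a b => ⟨⟨a.1 ⊔ b.1, fun q hq => ((q.sup_iff _ _).1 hq).elim (a.2 ·) (b.2 ·)⟩,
      fun q hq => q.mono le_sup_left hq, fun q hq => q.mono le_sup_right hq⟩)
  exact ⟨a.1, SetLike.coe_injective (a.2.antisymm ha)⟩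

end Lattice

section DistribLattice

variable {L : Type*} [DistribLattice L] [BoundedOrder L]

/-- The prime filter theorem, for a meet-closed and a join-closed set. -/
theorem exists_of_not_le {F I : L → Prop} (F_top : F ⊤) (F_inf : ∀ a b, F a → F b → F (a ⊓ b))
    (I_bot : I ⊥) (I_sup : ∀ a b, I a → I b → I (a ⊔ b)) (h : ∀ a b, F a → I b → ¬a ≤ b) :
    ∃ p : PrimePoint L, (∀ a, F a → p.1 a = true) ∧ ∀ a, I a → ¬p.1 a = true := by
  have hF : Order.IsPFilter {c : L | ∃ a, F a ∧ a ≤ c} := by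
    refine .of_def ⟨⊤, ⊤, F_top, le_rfl⟩ ?_ fun hxy ⟨a, ha, hax⟩ => ⟨a, ha, hax.trans hxy⟩
    rintro x ⟨a, ha, hax⟩ y ⟨b, hb, hby⟩
    exact ⟨x ⊓ y, ⟨a ⊓ b, F_inf a b ha hb, inf_le_inf hax hby⟩, inf_le_left, inf_le_right⟩
  have hI : Order.IsIdeal {c : L | ∃ a, I a ∧ c ≤ a} := by
    refine ⟨fun x y hyx ⟨a, ha, hxa⟩ => ⟨a, ha, hyx.trans hxa⟩, ⟨⊥, ⊥, I_bot, le_rfl⟩, ?_⟩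
    rintro x ⟨a, ha, hax⟩ y ⟨b, hb, hby⟩
    exact ⟨x ⊔ y, ⟨a ⊔ b, I_sup a b ha hb, sup_le_sup hax hby⟩, le_sup_left, le_sup_right⟩
  have hFI : Disjoint (hF.toPFilter : Set L) (hI.toIdeal : Set L) := by
    refine Set.disjoint_left.2 ?_
    rintro c ⟨a, ha, hac⟩ ⟨b, hb, hcb⟩
    exact h a b ha hb (le_trans hac hcb)
  obtain ⟨J, hJ, hIJ, hFJ⟩ := DistribLattice.prime_ideal_of_disjoint_filter_ideal hFI
  have F_J (a : L) (ha : F a) : a ∉ J := Set.disjoint_left.1 hFJ ⟨a, ha, le_refl a⟩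
  have J_of_le {a b : L} (hab : a ≤ b) (hb : b ∈ J) : a ∈ J := J.lower hab hb
  -- The complement of a prime ideal is a prime filter.
  refine ⟨ofPred (· ∉ J) (F_J _ F_top) (not_not.2 J.bot_mem) (fun a b => ?_) (fun a b => ?_),
    fun a ha => by simpa [ofPred] using F_J a ha,
    fun a ha => by simpa [ofPred] using hIJ ⟨a, ha, le_refl a⟩⟩
  · rw [Order.Ideal.sup_mem_iff, not_and_or]
  · rw [← not_or, not_iff_not]
    exact ⟨hJ.mem_or_mem, fun h => h.elim (J_of_le inf_le_left) (J_of_le inf_le_right)⟩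

/-- If `a ≤ b` fails, a prime filter separates the principal filter of `a` from the principal ideal
of `b`. Distributivity enters here, through the prime filter theorem. -/
theorem basic_le_basic {a b : L} : basic a ≤ basic b ↔ a ≤ b := by
  refine ⟨fun h => by_contra fun hab => ?_, fun h p hp => p.mono h hp⟩
  obtain ⟨p, hpa, hpb⟩ := exists_of_not_le (F := (a ≤ ·)) (I := (· ≤ b)) le_top
    (fun _ _ => le_inf) bot_le (fun _ _ => sup_le)
    (fun c d hc hd hcd => hab (hc.trans (hcd.trans hd)))
  exact hpb b le_rfl (h (hpa a le_rfl))

end DistribLattice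

end PrimePoint

/-! ### Points and maps recovered from lattices of clopen upper sets. -/

namespace ClopenUpperSet

section Basic

variable {X : Type*} [TopologicalSpace X] [PartialOrder X]

theorem ext_mem {U V : ClopenUpperSet X} (h : ∀ x, x ∈ U ↔ x ∈ V) : U = V :=
  SetLike.ext h

theorem mem_iff_of_eq {U V : ClopenUpperSet X} (h : U = V) (x : X) : x ∈ U ↔ x ∈ V :=
  SetLike.ext_iff.1 h x

theorem mem_sup_iff {U V : ClopenUpperSet X} {x : X} : x ∈ U ⊔ V ↔ x ∈ U ∨ x ∈ V :=
  Iff.rfl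

theorem mem_inf_iff {U V : ClopenUpperSet X} {x : X} : x ∈ U ⊓ V ↔ x ∈ U ∧ x ∈ V :=
  Iff.rfl

theorem mem_top_iff {x : X} : x ∈ (⊤ : ClopenUpperSet X) ↔ True :=
  Iff.rfl

theorem mem_bot_iff {x : X} : x ∈ (⊥ : ClopenUpperSet X) ↔ False :=
  Iff.rfl

instance : DistribLattice (ClopenUpperSet X) :=
  { (inferInstance : Lattice (ClopenUpperSet X)) with
    le_sup_inf := fun U V W x hx => by
      simp only [mem_sup_iff, mem_inf_iff] at hx ⊢
      tauto }

/-- The preimage of clopen upper sets along a continuous monotone map. -/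
def comap {Y : Type*} [TopologicalSpace Y] [PartialOrder Y] (g : X →Co Y) :
    BoundedLatticeHom (ClopenUpperSet Y) (ClopenUpperSet X) where
  toFun V := ⟨⟨g ⁻¹' V, V.isClopen.preimage g.continuous_toFun⟩, V.upper.preimage g.monotone'⟩
  map_sup' _ _ := rfl
  map_inf' _ _ := rfl
  map_top' := rfl
  map_bot' := rfl

/-- The prime filter of the clopen upper sets containing a point. -/
noncomputable def evalPoint (x : X) : PrimePoint (ClopenUpperSet X) :=
  .ofPred (x ∈ ·) trivial id (fun _ _ => Iff.rfl) (fun _ _ => Iff.rfl)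

theorem evalPoint_apply {x : X} {U : ClopenUpperSet X} : (evalPoint x).1 U = true ↔ x ∈ U := by
  simp [evalPoint, PrimePoint.ofPred]

theorem continuous_evalPoint : Continuous (evalPoint (X := X)) := by
  refine Continuous.subtype_mk (continuous_pi fun U => ?_) _
  refine (IsLocallyConstant.iff_continuous _).1 ?_
  refine (IsLocallyConstant.iff_isOpen_fiber).2 fun b => ?_
  cases b
  · convert U.isClopen.compl.isOpen using 1
    ext x
    simp
  · convert U.isClopen.isOpen using 1
    ext x
    simp

/-- In a compact ordered space, every prime filter of clopen upper sets is determined by a point. -/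
theorem exists_forall_mem_iff [CompactSpace X] (p : PrimePoint (ClopenUpperSet X)) :
    ∃ x : X, ∀ U, x ∈ U ↔ p.1 U = true := by
  let ι := {t : ClopenUpperSet X × ClopenUpperSet X // p.1 t.1 = true ∧ ¬p.1 t.2 = true}
  -- A point realises `p` when it lies in each member of `p` and outside each non-member, that is,
  -- in every `K t`. An empty `K t` would put a member of `p` below a non-member.
  let K : ι → Set X := fun t => (t.1.1 : Set X) ∩ (t.1.2 : Set X)ᶜ
  have : Nonempty ι := ⟨⟨(⊤, ⊥), p.top, p.bot⟩⟩
  have K_closed (t : ι) : IsClosed (K t) :=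
    t.1.1.isClopen.isClosed.inter t.1.2.isClopen.compl.isClosed
  obtain ⟨x, hx⟩ := IsCompact.nonempty_iInter_of_directed_nonempty_isCompact_isClosed K
    (fun s t => ⟨⟨(s.1.1 ⊓ t.1.1, s.1.2 ⊔ t.1.2), (p.inf_iff _ _).2 ⟨s.2.1, t.2.1⟩,
        fun h => ((p.sup_iff _ _).1 h).elim s.2.2 t.2.2⟩,
      fun y hy => ⟨hy.1.1, fun h => hy.2 (Or.inl h)⟩,
      fun y hy => ⟨hy.1.2, fun h => hy.2 (Or.inr h)⟩⟩)
    (fun t => by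
      by_contra hne
      refine t.2.2 (p.mono (fun y hy => by_contra fun hy' => hne ⟨y, hy, hy'⟩) t.2.1))
    (fun t => (K_closed t).isCompact) K_closed
  rw [Set.mem_iInter] at hx
  refine ⟨x, fun U => ⟨fun hU => by_contra fun hp => ?_, fun hp => ?_⟩⟩
  · exact (hx ⟨(⊤, U), p.top, hp⟩).2 hU
  · exact (hx ⟨(U, ⊥), hp, p.bot⟩).1

end Basic

section Priestley

variable {X : Type*} [TopologicalSpace X] [PartialOrder X] [PriestleySpace X]

theorem le_iff_forall_mem {x y : X} : x ≤ y ↔ ∀ U : ClopenUpperSet X, x ∈ U → y ∈ U := by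
  refine ⟨fun h U hx => U.upper h hx, fun h => by_contra fun hxy => ?_⟩
  obtain ⟨U, hU, hU', hx, hy⟩ := exists_isClopen_upper_of_not_le hxy
  exact hy (h ⟨⟨U, hU⟩, hU'⟩ hx)

theorem eq_of_forall_mem_iff {x y : X} (h : ∀ U : ClopenUpperSet X, x ∈ U ↔ y ∈ U) : x = y :=
  le_antisymm (le_iff_forall_mem.2 fun U => (h U).1) (le_iff_forall_mem.2 fun U => (h U).2)

theorem evalPoint_injective : Function.Injective (evalPoint (X := X)) := fun x y h =>
  eq_of_forall_mem_iff fun U => by rw [← evalPoint_apply, h, evalPoint_apply]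

/-- Every homomorphism between lattices of clopen upper sets is the preimage along a continuous
monotone map. -/
theorem exists_comap_eq [CompactSpace X] {Y : Type*} [TopologicalSpace Y] [PartialOrder Y]
    (α : BoundedLatticeHom (ClopenUpperSet X) (ClopenUpperSet Y)) :
    ∃ g : Y →Co X, comap g = α := by
  have key (y : Y) : ∃ x : X, ∀ U, x ∈ U ↔ y ∈ α U := by
    obtain ⟨x, hx⟩ := exists_forall_mem_iff (X := X) (.ofPred (fun U => y ∈ α U)
      (by simp [mem_top_iff]) (by simp [mem_bot_iff])
      (fun U V => by rw [map_sup, mem_sup_iff]) (fun U V => by rw [map_inf, mem_inf_iff]))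
    exact ⟨x, fun U => by simp [hx, PrimePoint.ofPred]⟩
  choose g hg using key
  -- Continuity into `X` can thus be tested after `evalPoint`, where the coordinates of `g` are
  -- indicator functions of the clopen sets `α U`.
  have embed : Topology.IsClosedEmbedding (evalPoint (X := X)) :=
    continuous_evalPoint.isClosedEmbedding evalPoint_injective
  have g_cont : Continuous g := by
    rw [embed.continuous_iff]
    refine Continuous.subtype_mk (continuous_pi fun U => ?_) _
    refine (IsLocallyConstant.iff_continuous _).1 ?_
    refine (IsLocallyConstant.iff_isOpen_fiber).2 fun b => ?_
    cases b
    · convert (α U).isClopen.compl.isOpen using 1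
      ext x
      simp [hg]
    · convert (α U).isClopen.isOpen using 1
      ext x
      simp [hg]
  refine ⟨⟨⟨g, fun y z hyz => le_iff_forall_mem.2 fun U hy => ?_⟩, g_cont⟩, ?_⟩
  · exact (hg z U).2 ((α U).upper hyz ((hg y U).1 hy))
  · ext U : 1
    exact SetLike.ext fun y => hg y U

end Priestley

end ClopenUpperSet

/-! ### Extension to prime filters, and the dual space of a FIDL-module. -/

namespace FIMod

variable (M : FIMod.{u, v})

theorem f_mono {x y : M.A} {b c : M.B} (h : x ≤ y) (h' : b ≤ c) : M.f x b ≤ M.f y c := by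
  refine le_trans (b := M.f y b) ?_ ?_
  · rw [← sup_eq_right.2 h, f_sup_left]
    exact le_sup_left
  · rw [← sup_eq_right.2 h', f_sup_right]
    exact le_sup_left

theorem i_mono {x y : M.A} {b c : M.B} (h : x ≤ y) (h' : b ≤ c) : M.i c x ≤ M.i b y := by
  rw [← inf_eq_left.2 h, ← sup_eq_right.2 h', i_sup, i_inf]
  exact inf_le_left.trans inf_le_right

variable {M}

/-- A pair of meet-closed sets whose fusion lies in a prime filter extends to a pair of prime
filters with the same property. -/
theorem exists_primePoint_f {G : M.A → Prop} {H : M.B → Prop} (G_top : G ⊤)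
    (G_inf : ∀ a b, G a → G b → G (a ⊓ b)) (H_top : H ⊤) (H_inf : ∀ a b, H a → H b → H (a ⊓ b))
    (r : PrimePoint M.A) (h : ∀ a b, G a → H b → r.1 (M.f a b) = true) :
    ∃ (p : PrimePoint M.A) (q : PrimePoint M.B), (∀ a, G a → p.1 a = true) ∧
      (∀ b, H b → q.1 b = true) ∧
      ∀ a b, p.1 a = true → q.1 b = true → r.1 (M.f a b) = true := by
  -- The two sets are enlarged one at a time: `G` is separated from the elements that some member of
  -- `H` sends outside `r`, and then `H` is treated likewise with `p` in place of `G`.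
  obtain ⟨p, hpG, hp⟩ := PrimePoint.exists_of_not_le
    (I := fun a => ∃ b, H b ∧ ¬r.1 (M.f a b) = true) G_top G_inf
    ⟨⊤, H_top, by rw [f_bot_left]; exact r.bot⟩
    (by
      rintro a a' ⟨b, hb, hab⟩ ⟨b', hb', hab'⟩
      refine ⟨b ⊓ b', H_inf _ _ hb hb', ?_⟩
      rw [f_sup_left, r.sup_iff, not_or]
      exact ⟨fun h => hab (r.mono (M.f_mono le_rfl inf_le_left) h),
        fun h => hab' (r.mono (M.f_mono le_rfl inf_le_right) h)⟩)
    (by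
      rintro a c ha ⟨b, hb, hcb⟩ hac
      exact hcb (r.mono (M.f_mono hac le_rfl) (h a b ha hb)))
  obtain ⟨q, hqH, hq⟩ := PrimePoint.exists_of_not_le
    (I := fun b => ∃ a, p.1 a = true ∧ ¬r.1 (M.f a b) = true) H_top H_inf
    ⟨⊤, p.top, by rw [f_bot_right]; exact r.bot⟩
    (by
      rintro b b' ⟨a, ha, hab⟩ ⟨a', ha', hab'⟩
      refine ⟨a ⊓ a', (p.inf_iff _ _).2 ⟨ha, ha'⟩, ?_⟩
      rw [f_sup_right, r.sup_iff, not_or]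
      exact ⟨fun h => hab (r.mono (M.f_mono inf_le_left le_rfl) h),
        fun h => hab' (r.mono (M.f_mono inf_le_right le_rfl) h)⟩)
    (by
      rintro b c hb ⟨a, ha, hac⟩ hbc
      exact hp a ⟨b, hb, fun h => hac (r.mono (M.f_mono le_rfl hbc) h)⟩ ha)
  exact ⟨p, q, hpG, hqH, fun a b ha hb => by_contra fun hab => hq b ⟨a, ha, hab⟩ hb⟩

/-- A meet-closed set `H` and a join-closed set `I` whose implications avoid a prime filter extend
to a prime filter and a prime ideal with the same property. -/
theorem exists_primePoint_i {H : M.B → Prop} {I : M.A → Prop} (H_top : H ⊤)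
    (H_inf : ∀ a b, H a → H b → H (a ⊓ b)) (I_bot : I ⊥) (I_sup : ∀ a b, I a → I b → I (a ⊔ b))
    (r : PrimePoint M.A) (h : ∀ b c, H b → I c → ¬r.1 (M.i b c) = true) :
    ∃ (q : PrimePoint M.B) (p : PrimePoint M.A), (∀ b, H b → q.1 b = true) ∧
      (∀ c, I c → ¬p.1 c = true) ∧
      ∀ b c, q.1 b = true → r.1 (M.i b c) = true → p.1 c = true := by
  obtain ⟨q, hqH, hq⟩ := PrimePoint.exists_of_not_le
    (I := fun b => ∃ c, I c ∧ r.1 (M.i b c) = true) H_top H_inf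
    ⟨⊥, I_bot, by rw [i_bot]; exact r.top⟩
    (by
      rintro b b' ⟨c, hc, hbc⟩ ⟨c', hc', hbc'⟩
      refine ⟨c ⊔ c', I_sup _ _ hc hc', ?_⟩
      rw [i_sup, r.inf_iff]
      exact ⟨r.mono (M.i_mono le_sup_left le_rfl) hbc,
        r.mono (M.i_mono le_sup_right le_rfl) hbc'⟩)
    (by
      rintro b b' hb ⟨c, hc, hbc⟩ hbb
      exact h b c hb hc (r.mono (M.i_mono le_rfl hbb) hbc))
  -- With `q` fixed, the elements `c` that must lie in `p` form a meet-closed set; the choice of `q`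
  -- keeps it from lying below `I`.
  obtain ⟨p, hp, hpI⟩ := PrimePoint.exists_of_not_le
    (F := fun c => ∃ b, q.1 b = true ∧ r.1 (M.i b c) = true) (I := I)
    ⟨⊤, q.top, by rw [i_top]; exact r.top⟩
    (by
      rintro c c' ⟨b, hb, hbc⟩ ⟨b', hb', hbc'⟩
      refine ⟨b ⊓ b', (q.inf_iff _ _).2 ⟨hb, hb'⟩, ?_⟩
      rw [i_inf, r.inf_iff]
      exact ⟨r.mono (M.i_mono le_rfl inf_le_left) hbc,
        r.mono (M.i_mono le_rfl inf_le_right) hbc'⟩)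
    I_bot I_sup
    (by
      rintro c c' ⟨b, hb, hbc⟩ hc hcc
      exact hq b ⟨c', hc, r.mono (M.i_mono hcc le_rfl) hbc⟩ hb)
  exact ⟨q, p, hqH, hpI, fun b c hb hbc => hp c ⟨b, hb, hbc⟩⟩

/-- The relation on prime filters dual to `f`. -/
def dualR (x : PrimePoint M.A) (y : PrimePoint M.B) (z : PrimePoint M.A) : Prop :=
  ∀ a b, x.1 a = true → y.1 b = true → z.1 (M.f a b) = true

/-- The relation on prime filters dual to `i`. -/
def dualT (x : PrimePoint M.B) (y z : PrimePoint M.A) : Prop :=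
  ∀ b c, x.1 b = true → y.1 (M.i b c) = true → z.1 c = true

open PrimePoint

/-- Only the inclusion from right to left has content: its witnesses extend the principal filters of
`a` and `b`. -/
theorem fusion_basic (a : M.A) (b : M.B) :
    fusion dualR (basic a : Set (PrimePoint M.A)) (basic b : Set (PrimePoint M.B)) =
      basic (M.f a b) := by
  ext r
  constructor
  · rintro ⟨p, hp, q, hq, h⟩
    exact h a b hp hq
  · intro hr
    obtain ⟨p, q, hp, hq, h⟩ := exists_primePoint_f (G := (a ≤ ·)) (H := (b ≤ ·)) le_top
      (fun _ _ => le_inf) le_top (fun _ _ => le_inf) r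
      (fun c d hc hd => r.mono (M.f_mono hc hd) hr)
    exact ⟨p, hp a le_rfl, q, hq b le_rfl, h⟩

/-- A prime filter omitting `M.i b c` is refuted by extending the principal filter of `b` and
separating from the principal ideal of `c`. -/
theorem implication_basic (b : M.B) (c : M.A) :
    implication dualT (basic b : Set (PrimePoint M.B)) (basic c : Set (PrimePoint M.A)) =
      basic (M.i b c) := by
  ext r
  constructor
  · intro hr
    by_contra hbc
    obtain ⟨q, p, hq, hp, h⟩ := exists_primePoint_i (H := (b ≤ ·)) (I := (· ≤ c)) le_top
      (fun _ _ => le_inf) bot_le (fun _ _ => sup_le) r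
      (fun d e hd he h => hbc (r.mono (M.i_mono he hd) h))
    exact hp c le_rfl (hr q p h (hq b le_rfl))
  · intro hr q p h hq
    exact h b c hq hr

variable (M)

/-- The Urquhart space of prime filters of a FIDL-module. -/
def dualSpace : USp.{u, v} where
  X := PrimePoint M.A
  Y := PrimePoint M.B
  R := dualR
  T := dualT
  fusion_isClopen V U := by
    obtain ⟨a, rfl⟩ := basic_surjective V
    obtain ⟨b, rfl⟩ := basic_surjective U
    exact fusion_basic a b ▸ (basic _).isClopen
  fusion_isUpperSet V U := by
    obtain ⟨a, rfl⟩ := basic_surjective V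
    obtain ⟨b, rfl⟩ := basic_surjective U
    exact fusion_basic a b ▸ (basic _).upper
  implication_isClopen U V := by
    obtain ⟨b, rfl⟩ := basic_surjective U
    obtain ⟨c, rfl⟩ := basic_surjective V
    exact implication_basic b c ▸ (basic _).isClopen
  implication_isUpperSet U V := by
    obtain ⟨b, rfl⟩ := basic_surjective U
    obtain ⟨c, rfl⟩ := basic_surjective V
    exact implication_basic b c ▸ (basic _).upper
  R_of_subset y x z h a b ha hb :=
    h (a := basic (M.f a b)) ⟨basic a, ha, basic b, hb, (fusion_basic a b).subset⟩
  T_of_subset x y z h b c hb hbc :=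
    h (a := basic c) ⟨basic b, hb, basic (M.i b c), hbc, (implication_basic b c).superset⟩

end FIMod

/-! ### The clopen upper set functor is full and faithful. -/

namespace USp

open ClopenUpperSet

/-- The FIDL-module of clopen upper sets of an Urquhart space. -/
def clopenModule (S : USp.{u, v}) : FIMod.{u, v} where
  A := ClopenUpperSet S.X
  B := ClopenUpperSet S.Y
  f V U := ⟨⟨fusion S.R V U, S.fusion_isClopen V U⟩, S.fusion_isUpperSet V U⟩
  i U V := ⟨⟨implication S.T U V, S.implication_isClopen U V⟩, S.implication_isUpperSet U V⟩
  f_sup_left V W U := ext_mem (X := S.X) fun z => by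
    constructor
    · rintro ⟨x, hx | hx, y, hy, h⟩
      exacts [Or.inl ⟨x, hx, y, hy, h⟩, Or.inr ⟨x, hx, y, hy, h⟩]
    · rintro (⟨x, hx, y, hy, h⟩ | ⟨x, hx, y, hy, h⟩)
      exacts [⟨x, Or.inl hx, y, hy, h⟩, ⟨x, Or.inr hx, y, hy, h⟩]
  f_sup_right V U W := ext_mem (X := S.X) fun z => by
    constructor
    · rintro ⟨x, hx, y, hy | hy, h⟩
      exacts [Or.inl ⟨x, hx, y, hy, h⟩, Or.inr ⟨x, hx, y, hy, h⟩]
    · rintro (⟨x, hx, y, hy, h⟩ | ⟨x, hx, y, hy, h⟩)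
      exacts [⟨x, hx, y, Or.inl hy, h⟩, ⟨x, hx, y, Or.inr hy, h⟩]
  f_bot_left U := ext_mem (X := S.X) fun z => ⟨fun ⟨_, hx, _⟩ => hx, False.elim⟩
  f_bot_right V := ext_mem (X := S.X) fun z => ⟨fun ⟨_, _, _, hy, _⟩ => hy, False.elim⟩
  i_inf U V W := ext_mem (X := S.X) fun y =>
    ⟨fun h => ⟨fun x z hT hx => (h x z hT hx).1, fun x z hT hx => (h x z hT hx).2⟩,
      fun h x z hT hx => ⟨h.1 x z hT hx, h.2 x z hT hx⟩⟩
  i_sup U V W := ext_mem (X := S.X) fun y =>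
    ⟨fun h => ⟨fun x z hT hx => h x z hT (Or.inl hx), fun x z hT hx => h x z hT (Or.inr hx)⟩,
      fun h x z hT hx => hx.elim (h.1 x z hT) (h.2 x z hT)⟩
  i_top U := ext_mem (X := S.X) fun y => ⟨fun _ => trivial, fun _ _ _ _ _ => trivial⟩
  i_bot V := ext_mem (X := S.X) fun y => ⟨fun _ => trivial, fun _ _ _ _ hx => hx.elim⟩

/-- The FIDL-homomorphism of preimages along a U-map. -/
def clopenHom {S S' : USp.{u, v}} (φ : S ⟶ S') : clopenModule S' ⟶ clopenModule S where
  α := comap (Hom.g φ)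
  γ := comap (Hom.h φ)
  map_f V U := ext_mem (X := S.X) fun z => by
    constructor
    · rintro ⟨x', hx', y', hy', h⟩
      obtain ⟨x, y, hR, hx, hy⟩ := Hom.lift_R φ x' y' z h
      exact ⟨x, V.upper hx hx', y, U.upper hy hy', hR⟩
    · rintro ⟨x, hx, y, hy, h⟩
      exact ⟨_, hx, _, hy, Hom.map_R φ x y z h⟩
  map_i U V := ext_mem (X := S.X) fun y => by
    constructor
    · exact fun h x z hT hx => h _ _ (Hom.map_T φ x y z hT) hx
    · intro h x' z' hT hx'
      obtain ⟨x, z, hT', hx, hz⟩ := Hom.lift_T φ x' y z' hT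
      exact V.upper hz (h x z hT' (U.upper hx hx'))

/-- The contravariant functor taking an Urquhart space to its FIDL-module of clopen upper sets. -/
def clopenFunctor : USp.{u, v} ⥤ FIMod.{u, v}ᵒᵖ where
  obj S := op (clopenModule S)
  map φ := (clopenHom φ).op
  map_id _ := rfl
  map_comp _ _ := rfl

instance : clopenFunctor.{u, v}.Faithful where
  map_injective {S S'} φ ψ h := by
    have h' : clopenHom φ = clopenHom ψ := Quiver.Hom.op_inj h
    refine Hom.ext (DFunLike.ext _ _ fun x => eq_of_forall_mem_iff fun U => ?_)
      (DFunLike.ext _ _ fun y => eq_of_forall_mem_iff fun U => ?_)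
    · exact mem_iff_of_eq (X := S.X)
        (DFunLike.congr_fun (congrArg FIMod.Hom.α h') U) x
    · exact mem_iff_of_eq (X := S.Y)
        (DFunLike.congr_fun (congrArg FIMod.Hom.γ h') U) y

/-- Priestley duality yields `g` and `h`. Since preimages commute with the operations, (M1) and (N1)
follow from the closure axioms of the target, and (M2) and (N2) from prime extension in the source.
-/
theorem clopenHom_surjective {S S' : USp.{u, v}} (ψ : clopenModule S' ⟶ clopenModule S) :
    ∃ φ : S ⟶ S', clopenHom φ = ψ := by
  obtain ⟨g, hg⟩ := exists_comap_eq (X := S'.X) (Y := S.X) (FIMod.Hom.α ψ)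
  obtain ⟨h, hh⟩ := exists_comap_eq (X := S'.Y) (Y := S.Y) (FIMod.Hom.γ ψ)
  have map_f (V : ClopenUpperSet S'.X) (U : ClopenUpperSet S'.Y) (z : S.X) :
      g z ∈ fusion S'.R V U ↔ z ∈ fusion S.R (g ⁻¹' V) (h ⁻¹' U) := by
    have := FIMod.Hom.map_f ψ V U
    rw [← hg, ← hh] at this
    exact mem_iff_of_eq (X := S.X) this z
  have map_i (U : ClopenUpperSet S'.Y) (V : ClopenUpperSet S'.X) (y : S.X) :
      g y ∈ implication S'.T U V ↔ y ∈ implication S.T (h ⁻¹' U) (g ⁻¹' V) := by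
    have := FIMod.Hom.map_i ψ U V
    rw [← hg, ← hh] at this
    exact mem_iff_of_eq (X := S.X) this y
  refine ⟨Hom.mk g h ?_ ?_ ?_ ?_, FIMod.Hom.ext hg hh⟩
  · intro x y z hR
    refine S'.R_of_subset _ _ _ ?_
    rintro W ⟨V, hV, U, hU, hW⟩
    exact hW ((map_f V U z).2 ⟨x, hV, y, hU, hR⟩)
  · intro x' y' z hR
    -- The preimages of the neighbourhoods of `x'` and `y'` have their fusions in the filter of `z`.
    -- Points realising the prime extensions lie over `x'` and `y'`.
    obtain ⟨p, q, hp, hq, hpq⟩ := FIMod.exists_primePoint_f (M := clopenModule S)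
      (G := fun V => ∃ V' : ClopenUpperSet S'.X, x' ∈ V' ∧ V = comap g V')
      (H := fun U => ∃ U' : ClopenUpperSet S'.Y, y' ∈ U' ∧ U = comap h U')
      ⟨⊤, trivial, rfl⟩
      (by rintro _ _ ⟨V, hV, rfl⟩ ⟨W, hW, rfl⟩; exact ⟨V ⊓ W, ⟨hV, hW⟩, rfl⟩)
      ⟨⊤, trivial, rfl⟩
      (by rintro _ _ ⟨V, hV, rfl⟩ ⟨W, hW, rfl⟩; exact ⟨V ⊓ W, ⟨hV, hW⟩, rfl⟩)
      (evalPoint z)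
      (by
        rintro _ _ ⟨V, hV, rfl⟩ ⟨U, hU, rfl⟩
        exact evalPoint_apply.2 ((map_f V U z).1 ⟨x', hV, y', hU, hR⟩))
    obtain ⟨x, hx⟩ := exists_forall_mem_iff p
    obtain ⟨y, hy⟩ := exists_forall_mem_iff q
    refine ⟨x, y, S.R_of_subset _ _ _ ?_, le_iff_forall_mem.2 fun V hV => ?_,
      le_iff_forall_mem.2 fun U hU => ?_⟩
    · rintro W ⟨V, hV, U, hU, hW⟩
      exact hW (evalPoint_apply.1 (hpq V U ((hx V).1 hV) ((hy U).1 hU)))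
    · exact (hx (comap g V)).2 (hp _ ⟨V, hV, rfl⟩)
    · exact (hy (comap h U)).2 (hq _ ⟨U, hU, rfl⟩)
  · intro x y z hT
    refine S'.T_of_subset _ _ _ ?_
    rintro W ⟨U, hU, V, hV, hW⟩
    exact (map_i U W y).1 (hW hV) x z hT hU
  · intro x' y z' hT
    -- Keeping out of `p` the preimages of the clopen upper sets that miss `z'` is what forces `g z
    -- ≤ z'`.
    obtain ⟨q, p, hq, hp, hpq⟩ := FIMod.exists_primePoint_i (M := clopenModule S)
      (H := fun U => ∃ U' : ClopenUpperSet S'.Y, x' ∈ U' ∧ U = comap h U')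
      (I := fun V => ∃ V' : ClopenUpperSet S'.X, z' ∉ V' ∧ V = comap g V')
      ⟨⊤, trivial, rfl⟩
      (by rintro _ _ ⟨V, hV, rfl⟩ ⟨W, hW, rfl⟩; exact ⟨V ⊓ W, ⟨hV, hW⟩, rfl⟩)
      ⟨⊥, id, rfl⟩
      (by rintro _ _ ⟨V, hV, rfl⟩ ⟨W, hW, rfl⟩; exact ⟨V ⊔ W, fun h => h.elim hV hW, rfl⟩)
      (evalPoint y)
      (by
        rintro _ _ ⟨U, hU, rfl⟩ ⟨V, hV, rfl⟩ hy
        exact hV ((map_i U V y).2 (evalPoint_apply.1 hy) x' z' hT hU))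
    obtain ⟨x, hx⟩ := exists_forall_mem_iff q
    obtain ⟨z, hz⟩ := exists_forall_mem_iff p
    refine ⟨x, z, S.T_of_subset _ _ _ ?_, le_iff_forall_mem.2 fun U hU => ?_,
      le_iff_forall_mem.2 fun V hV => by_contra fun hV' => ?_⟩
    · rintro W ⟨U, hU, V, hV, hW⟩
      exact (hz W).2 (hpq U W ((hx U).1 hU) (evalPoint_apply.2 (hW hV)))
    · exact (hx (comap h U)).2 (hq _ ⟨U, hU, rfl⟩)
    · exact hp _ ⟨V, hV', rfl⟩ ((hz (comap g V)).1 hV)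

instance : clopenFunctor.{u, v}.Full where
  map_surjective {S S'} ψ := by
    obtain ⟨φ, hφ⟩ := clopenHom_surjective ψ.unop
    exact ⟨φ, congrArg Quiver.Hom.op hφ⟩

end USp

/-! ### Representation of FIDL-modules and the equivalence. -/

namespace PrimePoint

variable (L : Type*) [DistribLattice L] [BoundedOrder L]

/-- Priestley's representation of a bounded distributive lattice by clopen upper sets. -/
noncomputable def basicIso : L ≃o ClopenUpperSet (PrimePoint L) :=
  RelIso.ofSurjective (OrderEmbedding.ofMapLEIff basic fun _ _ => basic_le_basic) basic_surjective

end PrimePoint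

namespace FIMod

open PrimePoint

/-- A FIDL-module is isomorphic to the clopen upper sets of its dual space. -/
noncomputable def isoClopenModule (M : FIMod.{u, v}) : M ≅ M.dualSpace.clopenModule where
  hom :=
    { α := (basicIso M.A : BoundedLatticeHom M.A (ClopenUpperSet (PrimePoint M.A)))
      γ := (basicIso M.B : BoundedLatticeHom M.B (ClopenUpperSet (PrimePoint M.B)))
      map_f := fun a b => SetLike.coe_injective (A := ClopenUpperSet (PrimePoint M.A))
        (fusion_basic a b).symm
      map_i := fun b a => SetLike.coe_injective (A := ClopenUpperSet (PrimePoint M.A))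
        (implication_basic b a).symm }
  inv :=
    { α := ((basicIso M.A).symm : BoundedLatticeHom (ClopenUpperSet (PrimePoint M.A)) M.A)
      γ := ((basicIso M.B).symm : BoundedLatticeHom (ClopenUpperSet (PrimePoint M.B)) M.B)
      map_f := fun V U => by
        -- Every clopen upper set is basic, so compatibility of the inverse reduces to
        -- `fusion_basic`.
        obtain ⟨a, rfl⟩ := (basicIso M.A).surjective V
        obtain ⟨b, rfl⟩ := (basicIso M.B).surjective U
        change (basicIso M.A).symm _ =
          M.f ((basicIso M.A).symm (basicIso M.A a)) ((basicIso M.B).symm (basicIso M.B b))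
        rw [OrderIso.symm_apply_apply, OrderIso.symm_apply_apply]
        refine (OrderIso.symm_apply_eq _).2 ?_
        exact SetLike.coe_injective (A := ClopenUpperSet (PrimePoint M.A)) (fusion_basic a b)
      map_i := fun U V => by
        obtain ⟨b, rfl⟩ := (basicIso M.B).surjective U
        obtain ⟨a, rfl⟩ := (basicIso M.A).surjective V
        change (basicIso M.A).symm _ =
          M.i ((basicIso M.B).symm (basicIso M.B b)) ((basicIso M.A).symm (basicIso M.A a))
        rw [OrderIso.symm_apply_apply, OrderIso.symm_apply_apply]
        refine (OrderIso.symm_apply_eq _).2 ?_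
        exact SetLike.coe_injective (A := ClopenUpperSet (PrimePoint M.A)) (implication_basic b a) }
  hom_inv_id := Hom.ext (DFunLike.ext _ _ (basicIso M.A).symm_apply_apply)
    (DFunLike.ext _ _ (basicIso M.B).symm_apply_apply)
  inv_hom_id := Hom.ext (DFunLike.ext _ _ (basicIso M.A).apply_symm_apply)
    (DFunLike.ext _ _ (basicIso M.B).apply_symm_apply)

end FIMod

instance : USp.clopenFunctor.{u, v}.EssSurj where
  mem_essImage M := ⟨M.unop.dualSpace, ⟨M.unop.isoClopenModule.op⟩⟩

instance : USp.clopenFunctor.{u, v}.IsEquivalence where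

theorem mainTheorem4 : Nonempty (FIMod.{u, v}ᵒᵖ ≌ USp.{u, v}) :=
  ⟨USp.clopenFunctor.asEquivalence.symm⟩
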